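/- Let $\mathbb{F}$ be an arbitrary field, let $K$ be a finite extension of the rational function field $\mathbb{F}(T)$, and let $\mathbb{F}_K$ be its constant field, i.e. the set of elements of $K$ that are algebraic over $\mathbb{F}$. Let $M_K$ be the set of places of $K$, i.e. of the discrete valuation rings $R_v\subseteq K$ with fraction field $K$ and $\mathbb{F}\subseteq R_v$; for $v\in M_K$ put $|x|_v=e^{-\mathrm{ord}_v(x)}$ and let $n_v$ be the degree over $\mathbb{F}$ of the residue field of $R_v$. Let $h(x)=\sum_{v\in M_K} n_v\log\max\{|x|_v,1\}$ for $x\in K$ and $h(\infty)=0$ be the standard height on $\mathbb{P}^1(K)=K\cup\{\infty\}$. Let $\phi\in K[z]$ be a polynomial of degree $d\ge 2$, acting on $\mathbb{P}^1(K)$ with $\phi(\infty)=\infty$, and let $\phi^n$ denote its $n$-th iterate. Let $\hat h_\phi(x)=\lim_{n\to\infty}d^{-n}h(\phi^n(x))$ be its canonical height, which satisfies $\hat h_\phi(\phi(x))=d\,\hat h_\phi(x)$ and $|\hat h_\phi(x)-h(x)|\le C$ for all $x\in\mathbb{P}^1(K)$, with a constant $C$ that does not depend on $x$. Suppose that there is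 no affine change of coordinates $\gamma(z)=az+b$ with $a\in K^\times$, $b\in K$ for which all coefficients of $\gamma^{-1}\circ\phi\circ\gamma$ lie in $\mathbb{F}_K$. Then a point $x\in\mathbb{P}^1(K)$ is preperiodic under $\phi$ (that is, $\phi^m(x)=\phi^n(x)$ for some $n>m\ge 0$) if and only if $\hat h_\phi(x)=0$; moreover, the set of points $x\in\mathbb{P}^1(K)$ with $\hat h_\phi(x)=0$ is finite. -/

import Mathlib

open Polynomial Filter Topology

noncomputable section

/-- A place of a function field `K` over `F`: a discrete valuation ring `R ⊆ K` with fraction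
field `K` that contains the scalars `F`. (A discrete valuation ring is integrally closed, so `R`
then contains every element of `K` that is algebraic over `F`, and it is a valuation subring.) -/
@[ext]
structure Place (F K : Type*) [Field F] [Field K] [Algebra F K] where
  /-- The valuation ring of the place. -/
  ring : ValuationSubring K
  /-- The valuation ring is discrete; in particular it is not `K` itself. -/
  isDVR : IsDiscreteValuationRing ring
  /-- The valuation is trivial on `F`. -/
  algebraMap_mem : ∀ c : F, algebraMap F K c ∈ ring

namespace Place

variable {F K : Type*} [Field F] [Field K] [Algebra F K]

instance (v : Place F K) : IsDiscreteValuationRing v.ring := v.isDVR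

instance (v : Place F K) : Algebra F v.ring :=
  ((algebraMap F K).codRestrict v.ring v.algebraMap_mem).toAlgebra

/-- The degree of a place: the degree over `F` of its residue field. -/
def degree (v : Place F K) : ℕ :=
  Module.finrank F (IsLocalRing.ResidueField v.ring)

/-- The absolute value `|x|_v = exp (-ord_v x)` of a place. -/
def absVal (v : Place F K) : AbsoluteValue K ℝ :=
  (IsDiscreteValuationRing.maximalIdeal v.ring).adicAbv (K := K)
    (b := ⟨Real.exp 1, (Real.exp_pos 1).le⟩)
    (show (1 : ℝ) < Real.exp 1 from Real.one_lt_exp_iff.mpr one_pos)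

end Place

/-- The height `h = ∑_v n_v log max (|x₀|_v, |x₁|_v)` on `ℙ¹(K) = K ∪ {∞}`, where `x ∈ K` has the
homogeneous coordinates `[x, 1]`, where `∞ = [1, 0]`, and where the weights `n_v = deg v` are the
ones of the product formula `∏_v |a|_v ^ (n_v) = 1`. -/
def height (F : Type*) {K : Type*} [Field F] [Field K] [Algebra F K] : OnePoint K → ℝ
  | .infty => ∑ᶠ v : Place F K, (v.degree : ℝ) * Real.log (max (v.absVal 1) (v.absVal 0))
  | .some x => ∑ᶠ v : Place F K, (v.degree : ℝ) * Real.log (max (v.absVal x) (v.absVal 1))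

/-- The action of a non-constant polynomial on `ℙ¹(K) = K ∪ {∞}`; it fixes `∞`. -/
def polyMap {K : Type*} [Field K] (φ : K[X]) : OnePoint K → OnePoint K :=
  OnePoint.map fun x : K => φ.eval x

/-- `x` is preperiodic under `f`: two different iterates of `f` agree at `x`. -/
def IsPreperiodic {α : Type*} (f : α → α) (x : α) : Prop :=
  ∃ m n : ℕ, m < n ∧ f^[m] x = f^[n] x

/-- The canonical height `lim d⁻ⁿ h(φⁿ(x))` of a polynomial `φ` of degree `d ≥ 2`. -/
def canonicalHeight (F : Type*) {K : Type*} [Field F] [Field K] [Algebra F K] (φ : K[X])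
    (x : OnePoint K) : ℝ :=
  limUnder atTop fun n : ℕ => height F ((polyMap φ)^[n] x) / (φ.natDegree : ℝ) ^ n

/-- The defining properties of the canonical height: the functional equation
`H(φ(x)) = d * H(x)`, and a bounded difference from the height. -/
def IsCanonicalHeight (F : Type*) {K : Type*} [Field F] [Field K] [Algebra F K] (φ : K[X])
    (H : OnePoint K → ℝ) : Prop :=
  (∀ x, H (polyMap φ x) = φ.natDegree * H x) ∧ ∃ C : ℝ, ∀ x, |H x - height F x| ≤ C

/-- The conjugate `γ⁻¹ ∘ φ ∘ γ` of `φ` by the affine change of coordinates `γ(z) = a z + b`,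
`a ≠ 0`. -/
def affineConj {K : Type*} [Field K] (a b : K) (φ : K[X]) : K[X] :=
  C a⁻¹ * (φ.comp (C a * X + C b) - C b)

/-- `φ` is defined over the constant field of `K`: every coefficient is algebraic over `F`. -/
def IsDefinedOverConstants (F : Type*) {K : Type*} [Field F] [Field K] [Algebra F K]
    (φ : K[X]) : Prop :=
  ∀ i : ℕ, φ.coeff i ∈ algebraicClosure F K

end

/-! A point of canonical height zero has an orbit of bounded height, hence a bounded orbit at every
place, because each local height is at most the height. So it suffices that only finitely many
points of `K` have bounded orbits everywhere; preperiodicity then follows from the pigeonhole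
principle, as the zero set of the canonical height is stable under `φ`.

Let `c` be the leading coefficient and `d` the degree. At almost every place bounded orbits lie in
the unit disc and `|c| ≤ 1`. At the others, the points with bounded orbit form finitely many sets of
diameter at most `r`, where `|c| r^(d-1) ≤ 1` (`IsNonarchimedean.exists_hasFiniteColoring`). This
holds although residue fields may be infinite. If there were infinitely many points, infinitely many
of them would have `|c| |x - y|^(d-1) ≤ 1` at all places, for themselves and for their images
(`FunctionField.exists_infinite_close`).

An element without poles is algebraic over `F`
(`FunctionField.isAlgebraic_of_forall_absVal_le_one`). Hence for two such points `c (x₁ - x₀)^(d-1)`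
is a nonzero constant, and every other such difference is a constant multiple of `a = x₁ - x₀`. In
the coordinate `(x - x₀) / a`, infinitely many constants have images whose differences are constant,
so interpolation makes all coefficients but the zeroth constant. The zeroth has no poles because `0`
has a bounded orbit. This contradicts the hypothesis on `φ`. -/

/-! ### Absolute values of places -/

theorem exists_adicAbv_eq_zpow {R K : Type*} [CommRing R] [IsDedekindDomain R] [Field K]
    [Algebra R K] [IsFractionRing R K] (v : IsDedekindDomain.HeightOneSpectrum R) {b : NNReal}
    (hb : 1 < b) {x : K} (hx : x ≠ 0) : ∃ k : ℤ, v.adicAbv hb x = (b : ℝ) ^ k := by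
  have h0 : v.valuation K x ≠ 0 := (Valuation.ne_zero_iff _).mpr hx
  refine ⟨Multiplicative.toAdd (WithZero.unzero h0), ?_⟩
  change ((WithZeroMulInt.toNNReal (ne_zero_of_lt hb) (v.valuation K x) : NNReal) : ℝ) = _
  rw [WithZeroMulInt.toNNReal_neg_apply _ h0, NNReal.coe_zpow]

namespace Place

variable {F K : Type*} [Field F] [Field K] [Algebra F K] (v : Place F K)

theorem isNonarchimedean_absVal : IsNonarchimedean v.absVal :=
  IsDedekindDomain.HeightOneSpectrum.isNonarchimedean_adicAbv _ _

theorem absVal_lt_one_iff (x : v.ring) :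
    v.absVal x < 1 ↔ x ∈ IsLocalRing.maximalIdeal v.ring :=
  IsDedekindDomain.HeightOneSpectrum.adicAbv_coe_lt_one_iff
    (IsDiscreteValuationRing.maximalIdeal v.ring) (K := K)
    (show (1 : ℝ) < Real.exp 1 from Real.one_lt_exp_iff.mpr one_pos) x

theorem absVal_le_one_iff {x : K} : v.absVal x ≤ 1 ↔ x ∈ v.ring := by
  refine ⟨fun h => ?_, fun h => ?_⟩
  · by_contra hx
    have hinv : x⁻¹ ∈ v.ring := (v.ring.mem_or_inv_mem x).resolve_left hx
    have hx0 : x ≠ 0 := by rintro rfl; exact hx v.ring.zero_mem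
    have hlt : v.absVal x⁻¹ < 1 := by
      refine (v.absVal_lt_one_iff ⟨x⁻¹, hinv⟩).mpr ?_
      rw [IsLocalRing.mem_maximalIdeal, mem_nonunits_iff]
      intro hu
      obtain ⟨⟨y, hy⟩, e⟩ := isUnit_iff_exists_inv.mp hu
      have e' : x⁻¹ * y = 1 := congrArg Subtype.val e
      have : y = x := by field_simp at e'; exact e'
      exact hx (this ▸ hy)
    rw [map_inv₀] at hlt
    have := (inv_lt_one₀ (v.absVal.pos hx0)).mp hlt
    linarith
  · exact IsDedekindDomain.HeightOneSpectrum.adicAbv_coe_le_one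
      (IsDiscreteValuationRing.maximalIdeal v.ring) (K := K)
      (show (1 : ℝ) < Real.exp 1 from Real.one_lt_exp_iff.mpr one_pos) ⟨x, h⟩

theorem exists_absVal_eq_exp {x : K} (hx : x ≠ 0) : ∃ k : ℤ, v.absVal x = Real.exp k := by
  obtain ⟨k, hk⟩ := exists_adicAbv_eq_zpow (IsDiscreteValuationRing.maximalIdeal v.ring)
    (show (1 : NNReal) < ⟨Real.exp 1, (Real.exp_pos 1).le⟩ from
      Real.one_lt_exp_iff.mpr one_pos) hx
  refine ⟨k, hk.trans ?_⟩
  change Real.exp 1 ^ k = _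
  rw [← Real.rpow_intCast, Real.exp_one_rpow]

theorem exists_absVal_lt_one : ∃ x : K, x ≠ 0 ∧ v.absVal x < 1 := by
  obtain ⟨ϖ, hϖ⟩ := IsDiscreteValuationRing.exists_irreducible v.ring
  refine ⟨ϖ, fun h => hϖ.ne_zero (Subtype.ext h), ?_⟩
  rw [absVal_lt_one_iff, IsLocalRing.mem_maximalIdeal]
  exact hϖ.not_isUnit

theorem absVal_le_one_of_isAlgebraic {x : K} (hx : IsAlgebraic F x) : v.absVal x ≤ 1 := by
  rw [absVal_le_one_iff]
  have hint : IsIntegral v.ring x := by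
    have : IsScalarTower F v.ring K := .of_algebraMap_eq fun _ => rfl
    exact hx.isIntegral.tower_top
  obtain ⟨y, rfl⟩ := IsIntegrallyClosed.isIntegral_iff.mp hint
  exact y.2

theorem absVal_eq_one_of_isAlgebraic {x : K} (hx : IsAlgebraic F x) (h0 : x ≠ 0) :
    v.absVal x = 1 := by
  refine le_antisymm (v.absVal_le_one_of_isAlgebraic hx) ?_
  have := v.absVal_le_one_of_isAlgebraic hx.inv
  rw [map_inv₀] at this
  exact (inv_le_one₀ (v.absVal.pos h0)).mp this

theorem isNontrivial_absVal : v.absVal.IsNontrivial := by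
  obtain ⟨x, hx, h⟩ := v.exists_absVal_lt_one
  exact ⟨x, hx, h.ne⟩

theorem not_isEquiv_of_ne {v w : Place F K} (h : v ≠ w) : ¬ v.absVal.IsEquiv w.absVal := by
  intro he
  apply h
  ext x
  rw [← absVal_le_one_iff, ← absVal_le_one_iff]
  simpa using he.le_iff_le (x := x) (y := 1)

end Place

/-! ### Linear relations over `F[t]` -/

section FunctionField
variable {F K : Type*} [Field F] [Field K] [Algebra F K]

/-- As long as all coefficients are divisible by `t`, one factor `t` can be cancelled; this lowers
the total degree. -/
theorem exists_coeff_zero_ne_zero_of_relation {ι : Type*} [Fintype ι] {t : K} (ht : t ≠ 0)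
    (ω : ι → K) : ∀ (N : ℕ) (h : ι → F[X]), ∑ i, (h i).natDegree = N → (∃ i, h i ≠ 0) →
      ∑ i, aeval t (h i) * ω i = 0 →
      ∃ g : ι → F[X], (∃ i, (g i).coeff 0 ≠ 0) ∧ ∑ i, aeval t (g i) * ω i = 0 := by
  intro N
  induction N using Nat.strong_induction_on with
  | _ N ih =>
    intro h hN hne hsum
    by_cases hc : ∃ i, (h i).coeff 0 ≠ 0
    · exact ⟨h, hc, hsum⟩
    push Not at hc
    have hX : ∀ i, h i = X * (h i).divX := fun i => by
      conv_lhs => rw [← X_mul_divX_add (h i), hc i, map_zero, add_zero]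
    obtain ⟨i₀, hi₀⟩ := hne
    have hd : (h i₀).divX ≠ 0 := fun e => hi₀ (by rw [hX i₀, e, mul_zero])
    refine ih _ ?_ (fun i => (h i).divX) rfl ⟨i₀, hd⟩ ?_
    · rw [← hN]
      refine Finset.sum_lt_sum (fun i _ => ?_) ⟨i₀, Finset.mem_univ _, ?_⟩
      · rw [natDegree_divX_eq_natDegree_tsub_one]; exact Nat.sub_le _ _
      · conv_rhs => rw [hX i₀, natDegree_X_mul hd]
        exact Nat.lt_succ_self _
    · have : t * ∑ i, aeval t (h i).divX * ω i = 0 := by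
        rw [Finset.mul_sum, ← hsum]
        refine Finset.sum_congr rfl fun i _ => ?_
        conv_rhs => rw [hX i, map_mul, aeval_X]
        ring
      exact (mul_eq_zero.mp this).resolve_left ht

variable [Algebra (RatFunc F) K] [IsScalarTower F (RatFunc F) K] [FunctionField F K]

/-- `K` has transcendence degree one, so it is algebraic over `F(t)`; it is also finitely generated
as a field. -/
theorem FunctionField.finiteDimensional_adjoin_of_transcendental {t : K}
    (ht : Transcendental F t) : FiniteDimensional (IntermediateField.adjoin F {t}) K := by
  have hX : IsTranscendenceBasis F fun _ : Unit => (X : F[X]) := .polynomial _ _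
  have h1 : IsTranscendenceBasis F (algebraMap F[X] (RatFunc F) ∘ fun _ : Unit => (X : F[X])) := by
    have : Algebra.IsAlgebraic F[X] (RatFunc F) :=
      IsLocalization.isAlgebraic (RatFunc F) (nonZeroDivisors F[X])
    exact hX.algebraMap_comp
  have h2 := h1.algebraMap_comp (A := K)
  have htr := h2.lift_cardinalMk_eq_trdeg
  have hb : IsTranscendenceBasis F fun _ : Unit => t := by
    refine AlgebraicIndependent.isTranscendenceBasis_of_lift_trdeg_le_of_finite
      (algebraicIndependent_unique_type_iff.mpr ht) ?_
    rw [htr]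
  have halg := hb.isAlgebraic_field
  rw [Set.range_const] at halg
  have : Algebra.EssFiniteType F (RatFunc F) := by
    have : Algebra.EssFiniteType F[X] (RatFunc F) := .of_isLocalization _ (nonZeroDivisors F[X])
    exact .comp F F[X] (RatFunc F)
  have : Algebra.EssFiniteType F K := .comp F (RatFunc F) K
  have : Algebra.EssFiniteType (IntermediateField.adjoin F {t}) K := .of_comp F _ K
  exact Algebra.finite_of_essFiniteType_of_isAlgebraic

/-- `N` is the degree of `K` over `F(t)`. A relation that survives modulo `t` is what the finiteness
statements about places need. -/
theorem FunctionField.exists_relation {t : K} (ht : Transcendental F t) :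
    ∃ N : ℕ, ∀ (ι : Type*) [Fintype ι], N < Fintype.card ι → ∀ ω : ι → K,
      ∃ g : ι → F[X], (∃ i, (g i).coeff 0 ≠ 0) ∧ ∑ i, aeval t (g i) * ω i = 0 := by
  classical
  have := finiteDimensional_adjoin_of_transcendental ht
  refine ⟨Module.finrank (IntermediateField.adjoin F {t}) K, fun ι _ hι ω => ?_⟩
  have hdep : ¬ LinearIndependent (IntermediateField.adjoin F {t}) ω := fun h =>
    hι.not_ge h.fintype_card_le_finrank
  obtain ⟨c, hc, i₀, hi₀⟩ := Fintype.not_linearIndependent_iff.mp hdep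
  have hrs : ∀ i, ∃ r s : F[X], (c i : K) = aeval t r / aeval t s := fun i =>
    (IntermediateField.mem_adjoin_simple_iff F _).mp (c i).2
  choose r s hrs using hrs
  -- A zero denominator is possible, the quotient then being `0`; it is replaced by `0 / 1`.
  have hs : ∀ i, ∃ r s : F[X], s ≠ 0 ∧ (c i : K) = aeval t r / aeval t s := fun i => by
    by_cases h0 : s i = 0
    · exact ⟨0, 1, one_ne_zero, by simp [hrs i, h0]⟩
    · exact ⟨r i, s i, h0, hrs i⟩
  choose r s hs hrs using hs
  have hs' : ∀ i, aeval t (s i) ≠ 0 := fun i =>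
    (transcendental_iff_injective.mp ht).ne_iff' (map_zero _) |>.mpr (hs i)
  refine exists_coeff_zero_ne_zero_of_relation (by rintro rfl; exact ht isAlgebraic_zero) ω _
    (fun i => r i * ∏ j ∈ Finset.univ.erase i, s j) rfl ⟨i₀, ?_⟩ ?_
  · refine mul_ne_zero (fun h => hi₀ (Subtype.ext ?_)) (Finset.prod_ne_zero_iff.mpr fun j _ => hs j)
    simp [hrs i₀, h]
  · have : (∏ j, aeval t (s j)) * ∑ i, (c i : K) * ω i = 0 := by
      have : ∑ i, (c i : K) * ω i = 0 := hc
      rw [this, mul_zero]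
    rw [Finset.mul_sum] at this
    rw [← this]
    refine Finset.sum_congr rfl fun i _ => ?_
    rw [← Finset.mul_prod_erase _ _ (Finset.mem_univ i), hrs i, map_mul, map_prod]
    field_simp [hs' i]

end FunctionField

theorem IsNonarchimedean.absVal_sum_le {K ι : Type*} [Field K] {f : AbsoluteValue K ℝ}
    (hf : IsNonarchimedean f) (s : Finset ι) (g : ι → K) {B : ℝ} (hB : 0 ≤ B)
    (h : ∀ i ∈ s, f (g i) ≤ B) : f (∑ i ∈ s, g i) ≤ B := by
  rcases s.eq_empty_or_nonempty with rfl | hs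
  · simpa using hB
  · obtain ⟨i, hi, hle⟩ := hf.finset_image_add_of_nonempty g hs
    exact hle.trans (h i hi)

/-! ### Finiteness of poles, residue degrees, and elements without poles -/

section FunctionField
variable {F K : Type*} [Field F] [Field K] [Algebra F K]

theorem Place.absVal_aeval_le_one (v : Place F K) {t : K} (ht : v.absVal t ≤ 1) (g : F[X]) :
    v.absVal (aeval t g) ≤ 1 := by
  rw [aeval_eq_sum_range]
  refine v.isNonarchimedean_absVal.absVal_sum_le _ _ zero_le_one fun i _ => ?_
  rw [Algebra.smul_def, map_mul, map_pow]
  exact mul_le_one₀ (v.absVal_le_one_of_isAlgebraic (isAlgebraic_algebraMap _)) (by positivity)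
    (pow_le_one₀ (v.absVal.nonneg _) ht)

theorem Place.absVal_aeval_eq_one (v : Place F K) {t : K} (ht : v.absVal t < 1) {g : F[X]}
    (hg : g.coeff 0 ≠ 0) : v.absVal (aeval t g) = 1 := by
  have hc : v.absVal (algebraMap F K (g.coeff 0)) = 1 :=
    v.absVal_eq_one_of_isAlgebraic (isAlgebraic_algebraMap _) (by simpa using hg)
  rw [← X_mul_divX_add g, map_add, map_mul, aeval_X, aeval_C, ← hc]
  refine v.isNonarchimedean_absVal.add_eq_right_of_lt ?_
  rw [hc, map_mul]
  exact mul_lt_one_of_nonneg_of_lt_one_left (v.absVal.nonneg _) ht (v.absVal_aeval_le_one ht.le _)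

variable [Algebra (RatFunc F) K] [IsScalarTower F (RatFunc F) K] [FunctionField F K]

theorem FunctionField.finite_setOf_one_lt_absVal (x : K) :
    {v : Place F K | 1 < v.absVal x}.Finite := by
  by_cases hx : IsAlgebraic F x
  · convert Set.finite_empty
    ext v
    simpa using v.absVal_le_one_of_isAlgebraic hx
  have ht : Transcendental F x⁻¹ := fun h => hx (by simpa using h.inv)
  obtain ⟨N, hN⟩ := exists_relation ht
  by_contra hinf
  obtain ⟨s, hs, hcard⟩ := Set.Infinite.exists_subset_card_eq hinf (N + 1)
  have key := AbsoluteValue.exists_one_lt_lt_one_pi_of_not_isEquiv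
    (v := fun v : s => v.1.absVal) (fun v => v.1.isNontrivial_absVal)
    (fun v w h => Place.not_isEquiv_of_ne fun e => h (Subtype.ext e))
  choose a ha ha' using key
  -- By approximation, `a v / (1 + a v)` has absolute value `1` at `v` and less than `1` at the
  -- other chosen poles. At the place `i` with `g i` nonzero modulo `t`, the `i`-th term alone has
  -- absolute value `1`, so the sum cannot vanish.
  obtain ⟨g, ⟨i, hi⟩, hsum⟩ := hN s (by simp [hcard]) fun v => a v / (1 + a v)
  have htlt : ∀ v : s, v.1.absVal x⁻¹ < 1 := fun v => by
    rw [map_inv₀]; exact inv_lt_one_of_one_lt₀ (hs v.2)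
  have hsame : i.1.absVal (a i / (1 + a i)) = 1 := by
    have : i.1.absVal (1 + a i) = i.1.absVal (a i) :=
      i.1.isNonarchimedean_absVal.add_eq_right_of_lt (by rw [map_one]; exact ha i)
    rw [map_div₀, this, div_self]
    linarith [ha i]
  have hdiff : ∀ j ≠ i, i.1.absVal (a j / (1 + a j)) < 1 := fun j hj => by
    have : i.1.absVal (1 + a j) = 1 := by
      rw [← i.1.absVal.map_one]
      exact i.1.isNonarchimedean_absVal.add_eq_left_of_lt
        (by rw [map_one]; exact ha' j i hj.symm)
    rw [map_div₀, this, div_one]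
    exact ha' j i hj.symm
  have hone : i.1.absVal (aeval x⁻¹ (g i) * (a i / (1 + a i))) = 1 := by
    rw [map_mul, hsame, mul_one, i.1.absVal_aeval_eq_one (htlt i) hi]
  have := i.1.isNonarchimedean_absVal.apply_sum_eq_of_lt (fun a => (i.1.absVal.map_neg a).symm)
    (Finset.mem_univ i) (l := fun v : s => aeval x⁻¹ (g v) * (a v / (1 + a v))) fun j _ hj => by
      rw [hone, map_mul]
      exact mul_lt_one_of_nonneg_of_lt_one_right
        (i.1.absVal_aeval_le_one (htlt i).le _) (i.1.absVal.nonneg _) (hdiff j hj)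
  rw [hone, hsum, map_zero] at this
  exact zero_ne_one this

theorem FunctionField.finite_setOf_absVal_ne_one {x : K} (hx : x ≠ 0) :
    {v : Place F K | v.absVal x ≠ 1}.Finite := by
  refine ((finite_setOf_one_lt_absVal x).union (finite_setOf_one_lt_absVal x⁻¹)).subset
    fun v hv => ?_
  rcases lt_or_gt_of_ne hv with h | h
  · right
    change 1 < v.absVal x⁻¹
    rw [map_inv₀]
    exact (one_lt_inv₀ (v.absVal.pos hx)).mpr h
  · exact .inl h

/-- Modulo `I` the element `t` vanishes, so a relation over `F[t]` between lifts becomes a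
nontrivial relation over `F`; this bounds the dimension by `N`. -/
theorem FunctionField.finite_quotient_of_transcendental_mem (V : ValuationSubring K) [Algebra F V]
    [IsScalarTower F V K] (I : Ideal V) {t : V} (htI : t ∈ I) (ht : Transcendental F (t : K)) :
    Module.Finite F (V ⧸ I) := by
  obtain ⟨N, hN⟩ := exists_relation ht
  rw [← Module.rank_lt_aleph0_iff]
  refine lt_of_le_of_lt (rank_le (n := N) fun s hs => ?_) (Cardinal.natCast_lt_aleph0)
  by_contra! hcard
  choose ω hω using fun i : s => Ideal.Quotient.mk_surjective i.1
  obtain ⟨g, ⟨i, hi⟩, hsum⟩ := hN s (by simpa using hcard) fun i => (ω i : K)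
  have hsum' : ∑ i, aeval t (g i) * ω i = 0 := by
    apply Subtype.ext
    rw [← ValuationSubring.subtype_apply, map_sum]
    refine (Finset.sum_congr rfl fun i _ => ?_).trans hsum
    rw [map_mul]
    congr 1
    exact (aeval_algebraMap_apply K t (g i)).symm
  have hmk : ∀ g : F[X], Ideal.Quotient.mk I (aeval t g) = algebraMap F (V ⧸ I) (g.coeff 0) := by
    intro g
    have : Ideal.Quotient.mk I t = 0 := Ideal.Quotient.eq_zero_iff_mem.mpr htI
    conv_lhs => rw [← X_mul_divX_add g]
    rw [map_add, map_add, map_mul, map_mul, aeval_X, this, zero_mul, zero_add, aeval_C]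
    rfl
  refine hi (Fintype.linearIndependent_iff.mp hs (fun i => (g i).coeff 0) ?_ i)
  have := congrArg (Ideal.Quotient.mk I) hsum'
  rw [map_sum, map_zero] at this
  rw [← this]
  refine Finset.sum_congr rfl fun i _ => ?_
  rw [map_mul, hmk, hω, Algebra.smul_def]

/-- Finiteness of the residue field extension is the point: `Module.finrank` would be `0` otherwise.
-/
theorem Place.degree_pos (v : Place F K) : 0 < v.degree := by
  obtain ⟨t, ht0, ht⟩ := v.exists_absVal_lt_one
  have htr : Transcendental F t := fun h => ht.ne (v.absVal_eq_one_of_isAlgebraic h ht0)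
  have hmem : (⟨t, v.absVal_le_one_iff.mp ht.le⟩ : v.ring) ∈ IsLocalRing.maximalIdeal v.ring :=
    (v.absVal_lt_one_iff ⟨t, _⟩).mp ht
  have : IsScalarTower F v.ring K := .of_algebraMap_eq fun _ => rfl
  have : Module.Finite F (IsLocalRing.ResidueField v.ring) :=
    FunctionField.finite_quotient_of_transcendental_mem v.ring _ hmem htr
  exact Module.finrank_pos

/-- For a nonzero `x` in `I`, either `x` is algebraic, hence a unit, or `V / (x)` has finite
dimension over `F`, so that `I` is finitely generated modulo `(x)`. -/
theorem FunctionField.isNoetherianRing_valuationSubring (V : ValuationSubring K) [Algebra F V]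
    [IsScalarTower F V K] : IsNoetherianRing V := by
  refine (isNoetherianRing_iff_ideal_fg V).mpr fun I => ?_
  by_cases hI : I = ⊥
  · rw [hI]; exact Submodule.fg_bot
  obtain ⟨x, hxI, hx0⟩ := Submodule.exists_mem_ne_zero_of_ne_bot hI
  by_cases hx : IsAlgebraic F (x : K)
  · have hint : IsIntegral V (x : K)⁻¹ := hx.inv.isIntegral.tower_top
    obtain ⟨y, hy⟩ := IsIntegrallyClosed.isIntegral_iff.mp hint
    have hxy : x * y = 1 := Subtype.ext (by
      change (x : K) * (y : K) = 1
      rw [show (y : K) = (x : K)⁻¹ from hy]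
      exact mul_inv_cancel₀ fun h => hx0 (Subtype.ext h))
    rw [Ideal.eq_top_of_unit_mem I x y hxI (by rw [mul_comm, hxy])]
    exact ⟨{1}, by simp⟩
  · have := finite_quotient_of_transcendental_mem V (Ideal.span {x})
      (Ideal.mem_span_singleton_self x) hx
    have hN : IsNoetherian V (V ⧸ Ideal.span {x}) := isNoetherian_of_tower F inferInstance
    refine Submodule.fg_of_fg_map_of_fg_inf_ker (Ideal.span {x}).mkQ (hN.noetherian _) ?_
    rw [Submodule.ker_mkQ, inf_eq_right.mpr ((Ideal.span_singleton_le_iff_mem I).mpr hxI)]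
    exact ⟨{x}, by simp⟩

/-- If `x` is transcendental, then `t = x⁻¹` is not a unit of `F[t]`, so some valuation ring
containing `F[t]` has `t` as a nonunit. Being Noetherian, it is a place, and `x` has a pole there.
-/
theorem FunctionField.isAlgebraic_of_forall_absVal_le_one {x : K}
    (hx : ∀ v : Place F K, v.absVal x ≤ 1) : IsAlgebraic F x := by
  by_contra htr
  have ht : Transcendental F x⁻¹ := fun h => htr (by simpa using h.inv)
  set t := x⁻¹ with ht_def
  have ht0 : t ≠ 0 := by intro h; rw [h] at ht; exact ht isAlgebraic_zero
  let A := Algebra.adjoin F {t}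
  let tA : A.toSubring := ⟨t, Algebra.subset_adjoin rfl⟩
  have hne : Ideal.span {tA} ≠ ⊤ := fun h => by
    obtain ⟨⟨y, hy⟩, e⟩ := Ideal.mem_span_singleton'.mp ((Ideal.eq_top_iff_one _).mp h)
    have e' : y * t = 1 := congrArg Subtype.val e
    obtain ⟨p, rfl⟩ := (Algebra.adjoin_singleton_eq_range_aeval F t ▸ hy :
      y ∈ (aeval t : F[X] →ₐ[F] K).range)
    have h0 : aeval t (p * X - 1) = 0 := by simp [sub_eq_zero]; exact e'
    have := (transcendental_iff.mp ht) _ h0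
    have := congrArg (eval 0) this
    simp at this
  obtain ⟨V, hAV, hV⟩ := Ideal.image_subset_nonunits_valuationSubring _ hne
  have hF : ∀ c : F, algebraMap F K c ∈ V := fun c => hAV (A.algebraMap_mem c)
  let : Algebra F V := ((algebraMap F K).codRestrict V hF).toAlgebra
  have : IsScalarTower F V K := .of_algebraMap_eq fun _ => rfl
  have := isNoetherianRing_valuationSubring (F := F) V
  have hxV : x ∉ V := by
    have : t ∈ V.nonunits := hV ⟨tA, Ideal.mem_span_singleton_self _, rfl⟩
    rw [ht_def, V.inv_mem_nonunits_iff] at this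
    exact this.resolve_left (by simpa [ht_def] using ht0)
  have hfield : ¬ IsField V := fun h => by
    have htV : t ∈ V := (V.mem_or_inv_mem x).resolve_left hxV
    obtain ⟨⟨y, hy⟩, e⟩ := h.mul_inv_cancel (a := ⟨t, htV⟩) fun h => ht0 (congrArg Subtype.val h)
    have e' : t * y = 1 := congrArg Subtype.val e
    refine hxV ?_
    convert hy
    rw [← inv_inv x, ← ht_def]
    exact inv_eq_of_mul_eq_one_right e'
  have hiff : IsDiscreteValuationRing V ↔ ValuationRing V :=
    (IsDiscreteValuationRing.TFAE V hfield).out 0 1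
  have hdvr : IsDiscreteValuationRing V := hiff.mpr inferInstance
  exact hxV ((Place.absVal_le_one_iff ⟨V, hdvr, hF⟩).mp (hx ⟨V, hdvr, hF⟩))

end FunctionField

/-- The orbit of `x` under the polynomial `φ` is bounded with respect to the absolute value `f`. -/
def HasBoundedOrbit {K : Type*} [Field K] (f : AbsoluteValue K ℝ) (φ : K[X]) (x : K) : Prop :=
  ∃ B : ℝ, ∀ n : ℕ, f ((fun y : K => φ.eval y)^[n] x) ≤ B

/-! ### Polynomial dynamics at one place -/

section LocalDynamics

variable {K : Type*} [Field K] {f : AbsoluteValue K ℝ} {φ : K[X]}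

theorem HasBoundedOrbit.eval {x : K} (h : HasBoundedOrbit f φ x) :
    HasBoundedOrbit f φ (φ.eval x) := by
  obtain ⟨B, hB⟩ := h
  exact ⟨B, fun n => hB (n + 1)⟩

theorem not_hasBoundedOrbit_of_growth {q ρ : ℝ} (hq : 1 < q) (hρ : 0 < ρ)
    (h : ∀ y, ρ ≤ f y → q * f y ≤ f (φ.eval y)) {x : K} (hx : ρ ≤ f x) :
    ¬ HasBoundedOrbit f φ x := by
  rintro ⟨B, hB⟩
  have key : ∀ n : ℕ, q ^ n * ρ ≤ f ((fun y : K => φ.eval y)^[n] x) := by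
    intro n
    induction n with
    | zero => simpa using hx
    | succ n ih =>
      rw [Function.iterate_succ_apply']
      have hρn : ρ ≤ f ((fun y : K => φ.eval y)^[n] x) :=
        (le_mul_of_one_le_left hρ.le (one_le_pow₀ hq.le)).trans ih
      refine le_trans ?_ (h _ hρn)
      rw [pow_succ', mul_assoc]
      exact mul_le_mul_of_nonneg_left ih (by linarith)
  obtain ⟨n, hn⟩ := pow_unbounded_of_one_lt (B / ρ) hq
  have := (key n).trans (hB n)
  rw [div_lt_iff₀ hρ] at hn
  linarith

theorem IsNonarchimedean.absVal_eval_eq (hf : IsNonarchimedean f) {x : K}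
    (h : ∀ i < φ.natDegree, f (φ.coeff i) * f x ^ i < f φ.leadingCoeff * f x ^ φ.natDegree) :
    f (φ.eval x) = f φ.leadingCoeff * f x ^ φ.natDegree := by
  rw [eval_eq_sum_range]
  refine (hf.apply_sum_eq_of_lt (fun a => (f.map_neg a).symm)
    (Finset.self_mem_range_succ φ.natDegree) fun j hj hne => ?_).trans (by simp)
  simpa using h j (lt_of_le_of_ne (Nat.lt_succ_iff.mp (Finset.mem_range.mp hj)) hne)

/-- One constant controls all coefficients and the inverse of the leading one. The last clause makes
it `1` at almost all places. -/
theorem exists_coeff_bound (f : AbsoluteValue K ℝ) (hφ : φ ≠ 0) :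
    ∃ M : ℝ, 1 ≤ M ∧ (∀ i, f (φ.coeff i) ≤ M) ∧ 1 ≤ M * f φ.leadingCoeff ∧
      ((∀ i ∈ φ.support, f (φ.coeff i) = 1) → M = 1) := by
  have hl : 0 < f φ.leadingCoeff := f.pos (leadingCoeff_ne_zero.mpr hφ)
  by_cases h : ∀ i ∈ φ.support, f (φ.coeff i) = 1
  · refine ⟨1, le_rfl, fun i => ?_, ?_, fun _ => rfl⟩
    · by_cases hi : i ∈ φ.support
      · exact (h i hi).le
      · simp [notMem_support_iff.mp hi]
    · rw [one_mul]
      exact (h _ (natDegree_mem_support_of_nonzero hφ)).ge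
  · have hs : 0 ≤ ∑ i ∈ φ.support, f (φ.coeff i) := Finset.sum_nonneg fun _ _ => f.nonneg _
    have hi := inv_pos.mpr hl
    refine ⟨1 + ∑ i ∈ φ.support, f (φ.coeff i) + (f φ.leadingCoeff)⁻¹, by linarith, fun i => ?_,
      ?_, fun h' => (h h').elim⟩
    · by_cases hmem : i ∈ φ.support
      · have := Finset.single_le_sum (f := fun i => f (φ.coeff i)) (fun _ _ => f.nonneg _) hmem
        linarith
      · rw [notMem_support_iff.mp hmem, map_zero]
        linarith
    · rw [add_mul, inv_mul_cancel₀ hl.ne']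
      have : 0 ≤ (1 + ∑ i ∈ φ.support, f (φ.coeff i)) * f φ.leadingCoeff := by positivity
      linarith

section Bound

variable {M : ℝ} (hM : 1 ≤ M) (hc : ∀ i, f (φ.coeff i) ≤ M)
  (hl : 1 ≤ M * f φ.leadingCoeff)

include hM hc in
theorem IsNonarchimedean.absVal_eval_le (hf : IsNonarchimedean f) (x : K) :
    f (φ.eval x) ≤ M * max (f x) 1 ^ φ.natDegree := by
  rw [eval_eq_sum_range]
  have h1 : (1 : ℝ) ≤ max (f x) 1 := le_max_right _ _
  refine hf.absVal_sum_le _ _ (by positivity) fun i hi => ?_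
  rw [map_mul, map_pow]
  refine mul_le_mul (hc i) ?_ (by positivity) (by linarith)
  calc f x ^ i ≤ max (f x) 1 ^ i := pow_le_pow_left₀ (f.nonneg _) (le_max_left _ _) _
    _ ≤ _ := pow_le_pow_right₀ h1 (Nat.lt_succ_iff.mp (Finset.mem_range.mp hi))

include hM hc hl in
theorem IsNonarchimedean.absVal_eval_eq_of_lt (hf : IsNonarchimedean f) {x : K}
    (hx : M ^ 2 < f x) : f (φ.eval x) = f φ.leadingCoeff * f x ^ φ.natDegree := by
  have hM0 : 0 < M := by linarith
  have h1x : 1 ≤ f x := (one_le_pow₀ hM).trans hx.le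
  refine hf.absVal_eval_eq fun i hi => ?_
  obtain ⟨k, hk⟩ : ∃ k, φ.natDegree = k + 1 := ⟨φ.natDegree - 1, by omega⟩
  rw [hk] at hi ⊢
  have hk0 : 0 < f x ^ k := by positivity
  calc f (φ.coeff i) * f x ^ i ≤ M * f x ^ k :=
        mul_le_mul (hc i) (pow_le_pow_right₀ h1x (by omega)) (by positivity) hM0.le
    _ ≤ (M * f φ.leadingCoeff) * (M * f x ^ k) := le_mul_of_one_le_left (by positivity) hl
    _ = f φ.leadingCoeff * (M ^ 2 * f x ^ k) := by ring
    _ < f φ.leadingCoeff * (f x * f x ^ k) := by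
        refine mul_lt_mul_of_pos_left (mul_lt_mul_of_pos_right hx hk0) ?_
        by_contra! h
        have : M * f φ.leadingCoeff ≤ 0 := mul_nonpos_of_nonneg_of_nonpos hM0.le h
        linarith
    _ = _ := by ring

include hM hc hl in
theorem IsNonarchimedean.pow_le_absVal_eval (hf : IsNonarchimedean f) (hd : 1 ≤ φ.natDegree)
    (x : K) : max (f x) 1 ^ φ.natDegree ≤ M ^ (2 * φ.natDegree) * max (f (φ.eval x)) 1 := by
  have hM0 : 0 < M := by linarith
  rcases lt_or_ge (M ^ 2) (f x) with hx | hx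
  · have h1x : 1 ≤ f x := (one_le_pow₀ hM).trans hx.le
    rw [max_eq_left h1x]
    calc f x ^ φ.natDegree ≤ (M * f φ.leadingCoeff) * f x ^ φ.natDegree :=
          le_mul_of_one_le_left (by positivity) hl
      _ = M * f (φ.eval x) := by rw [hf.absVal_eval_eq_of_lt hM hc hl hx]; ring
      _ ≤ M ^ (2 * φ.natDegree) * max (f (φ.eval x)) 1 :=
          mul_le_mul (le_self_pow₀ hM (by omega)) (le_max_left _ _) (f.nonneg _) (by positivity)
  · calc max (f x) 1 ^ φ.natDegree ≤ (M ^ 2) ^ φ.natDegree :=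
          pow_le_pow_left₀ (by positivity) (max_le hx (one_le_pow₀ hM)) _
      _ = M ^ (2 * φ.natDegree) := (pow_mul _ _ _).symm
      _ ≤ _ := le_mul_of_one_le_right (by positivity) (le_max_right _ _)

include hM hc hl in
theorem IsNonarchimedean.abs_log_eval_sub_le (hf : IsNonarchimedean f) (hd : 1 ≤ φ.natDegree)
    (x : K) : |Real.log (max (f (φ.eval x)) 1) - φ.natDegree * Real.log (max (f x) 1)| ≤
      2 * φ.natDegree * Real.log M := by
  have hM0 : 0 < M := by linarith
  have h1 : (1 : ℝ) ≤ max (f x) 1 := le_max_right _ _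
  have h2 : (1 : ℝ) ≤ max (f (φ.eval x)) 1 := le_max_right _ _
  have hpow : 1 ≤ max (f x) 1 ^ φ.natDegree := one_le_pow₀ h1
  have hlog : 0 ≤ Real.log M := Real.log_nonneg hM
  have hd' : (1 : ℝ) ≤ φ.natDegree := by exact_mod_cast hd
  have hup := Real.log_le_log (by positivity) (max_le (hf.absVal_eval_le hM hc x)
    (one_le_mul_of_one_le_of_one_le hM hpow))
  have hlow := Real.log_le_log (by positivity) (hf.pow_le_absVal_eval hM hc hl hd x)
  rw [Real.log_mul (by positivity) (by positivity), Real.log_pow] at hup hlow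
  rw [Real.log_pow] at hlow
  push_cast at hlow
  rw [abs_le]
  constructor
  · linarith
  · nlinarith

include hM hc hl in
theorem HasBoundedOrbit.absVal_le (hf : IsNonarchimedean f) (hd : 2 ≤ φ.natDegree) {x : K}
    (hx : HasBoundedOrbit f φ x) : f x ≤ M ^ 2 := by
  have hM0 : 0 < M := by linarith
  by_contra! h
  have hMx : M < f x := lt_of_le_of_lt (le_self_pow₀ hM two_ne_zero) h
  refine not_hasBoundedOrbit_of_growth (q := f x / M) (ρ := f x) ((one_lt_div hM0).mpr hMx)
    (by linarith) (fun y hy => ?_) le_rfl hx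
  have h1y : 1 ≤ f y := by linarith
  rw [hf.absVal_eval_eq_of_lt hM hc hl (h.trans_le hy), div_mul_eq_mul_div, div_le_iff₀ hM0]
  calc f x * f y ≤ f y * f y := mul_le_mul_of_nonneg_right hy (by linarith)
    _ = f y ^ 2 := by ring
    _ ≤ f y ^ φ.natDegree := pow_le_pow_right₀ h1y hd
    _ ≤ (M * f φ.leadingCoeff) * f y ^ φ.natDegree := le_mul_of_one_le_left (by positivity) hl
    _ = _ := by ring

end Bound

/-- If `b = |φ(0)| > 1`, the leading term dominates on `|y| ≥ b`, so `|φ(y)| = |y|^d ≥ b |y|` and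
the orbit of `0` escapes. -/
theorem HasBoundedOrbit.absVal_coeff_zero_le_one (hf : IsNonarchimedean f)
    (hd : 2 ≤ φ.natDegree) (hc : ∀ i ≠ 0, f (φ.coeff i) ≤ 1) (hl : f φ.leadingCoeff = 1)
    (h0 : HasBoundedOrbit f φ 0) : f (φ.coeff 0) ≤ 1 := by
  by_contra! hb
  refine not_hasBoundedOrbit_of_growth (q := f (φ.coeff 0)) (ρ := f (φ.coeff 0)) hb
    (by linarith) (fun y hy => ?_) le_rfl (coeff_zero_eq_eval_zero φ ▸ h0.eval)
  have h1y : 1 < f y := hb.trans_le hy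
  rw [hf.absVal_eval_eq fun i hi => ?_, hl, one_mul]
  · calc f (φ.coeff 0) * f y ≤ f y * f y := mul_le_mul_of_nonneg_right hy (by linarith)
      _ = f y ^ 2 := by ring
      _ ≤ f y ^ φ.natDegree := pow_le_pow_right₀ h1y.le hd
  · rw [hl, one_mul]
    rcases eq_or_ne i 0 with rfl | hi0
    · rw [pow_zero, mul_one]
      exact hy.trans_lt (lt_self_pow₀ h1y (by omega))
    · exact (mul_le_of_le_one_left (by positivity) (hc i hi0)).trans_lt
        (pow_lt_pow_right₀ h1y hi)

end LocalDynamics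

/-- `S` is a finite union of sets of diameter at most `r`, namely of the fibres of a colouring. -/
def HasFiniteColoring {K : Type*} [Field K] (f : AbsoluteValue K ℝ) (S : Set K) (r : ℝ) : Prop :=
  ∃ (N : ℕ) (κ : K → Fin N), ∀ x ∈ S, ∀ y ∈ S, κ x = κ y → f (x - y) ≤ r

/-! ### Covering bounded orbits by sets of small diameter -/

section Coloring

variable {K : Type*} [Field K] {f : AbsoluteValue K ℝ} {φ : K[X]}

theorem HasFiniteColoring.of_finite {α : Type*} [Finite α] {S : Set K} {r : ℝ} (κ : K → α)
    (h : ∀ x ∈ S, ∀ y ∈ S, κ x = κ y → f (x - y) ≤ r) : HasFiniteColoring f S r :=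
  ⟨Nat.card α, fun x => Finite.equivFin α (κ x), fun x hx y hy e =>
    h x hx y hy ((Finite.equivFin α).injective e)⟩

theorem IsNonarchimedean.sub_le (hf : IsNonarchimedean f) {x y : K} {r : ℝ} (hx : f x ≤ r)
    (hy : f y ≤ r) : f (x - y) ≤ r := by
  rw [sub_eq_add_neg]
  exact (hf _ _).trans (max_le hx (by rwa [f.map_neg]))

/-- A set whose image under a polynomial has small diameter splits into finitely many sets of
small diameter: by Lagrange interpolation, it has at most `d` points with large distances. -/
theorem IsNonarchimedean.hasFiniteColoring_of_eval (hf : IsNonarchimedean f) (hφ : 0 < φ.natDegree)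
    {S : Set K} {r s t : ℝ} (hs : 0 ≤ s) (hst : ∀ z, s < f z → t ≤ f z) (ht : 0 < t)
    (hS : ∀ x ∈ S, ∀ y ∈ S, f (φ.eval x - φ.eval y) ≤ r)
    (hlt : r < f φ.leadingCoeff * t ^ φ.natDegree) : HasFiniteColoring f S s := by
  classical
  let R : Setoid S :=
    { r := fun x y => f (x.1 - y.1) ≤ s
      iseqv :=
        { refl := fun x => by simpa using hs
          symm := fun {x y} h => by rwa [f.map_sub]
          trans := fun {x y z} h h' => by
            have := hf (x.1 - y.1) (y.1 - z.1)
            rw [sub_add_sub_cancel] at this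
            exact this.trans (max_le h h') } }
  have hfin : Finite (Quotient R) := by
    by_contra hinf
    rw [not_finite_iff_infinite] at hinf
    obtain ⟨T, hT⟩ := Infinite.exists_subset_card_eq (Quotient R) (φ.natDegree + 1)
    have hTne : T.Nonempty := Finset.card_pos.mp (by omega)
    obtain ⟨q₀, hq₀⟩ := hTne
    let v : Quotient R → K := fun q => (Quotient.out q).1
    have hsep : ∀ p q : Quotient R, p ≠ q → t ≤ f (v p - v q) := fun p q hpq => by
      refine hst _ (lt_of_not_ge fun h => hpq ?_)
      rw [← Quotient.out_eq p, ← Quotient.out_eq q]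
      exact Quotient.sound h
    have hinj : Set.InjOn v T := fun p _ q _ e => by
      by_contra hpq
      have := hsep p q hpq
      rw [e, sub_self, map_zero] at this
      linarith
    let P : K[X] := φ - C (φ.eval (v q₀))
    have hPdeg : P.natDegree = φ.natDegree := natDegree_sub_C
    have hP0 : P ≠ 0 := by
      intro h
      rw [h, natDegree_zero] at hPdeg
      omega
    have hPl : P.leadingCoeff = φ.leadingCoeff := by
      rw [leadingCoeff, hPdeg, coeff_sub, coeff_C_of_ne_zero hφ.ne', sub_zero, leadingCoeff]
    have hsum := Lagrange.leadingCoeff_eq_sum (P := P) hinj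
      (by rw [degree_eq_natDegree hP0, hPdeg, hT]; norm_cast)
    have hr : 0 ≤ r := (f.nonneg _).trans (hS _ (Quotient.out q₀).2 _ (Quotient.out q₀).2)
    -- In the interpolation formula each numerator is at most `r` and each denominator, a product of
    -- `d` differences, at least `t ^ d`.
    have hle : f P.leadingCoeff ≤ r / t ^ φ.natDegree := by
      rw [hsum]
      refine hf.absVal_sum_le _ _ (by positivity) fun q hq => ?_
      rw [map_div₀, map_prod]
      refine div_le_div₀ hr ?_ (by positivity) ?_
      · simpa [P] using hS _ (Quotient.out q).2 _ (Quotient.out q₀).2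
      · rw [show φ.natDegree = (T.erase q).card by rw [Finset.card_erase_of_mem hq, hT]; rfl,
          ← Finset.prod_const]
        exact Finset.prod_le_prod (fun _ _ => ht.le) fun p hp =>
          hsep _ _ (Finset.ne_of_mem_erase hp).symm
    rw [hPl, le_div_iff₀ (by positivity)] at hle
    linarith
  refine .of_finite (α := Option (Quotient R))
    (fun x => if hx : x ∈ S then some (Quotient.mk R ⟨x, hx⟩) else none) fun x hx y hy e => ?_
  simp only [hx, hy, dif_pos, Option.some.injEq] at e
  exact Quotient.exact e

/-- Points are first sorted by the colour of their image; within one class the images are `r`-close,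
so the class splits further. -/
theorem IsNonarchimedean.hasFiniteColoring_step (hf : IsNonarchimedean f)
    (hφ : 0 < φ.natDegree) {S : Set K} {r s t : ℝ} (hs : 0 ≤ s) (hst : ∀ z, s < f z → t ≤ f z)
    (ht : 0 < t) (hS : ∀ x ∈ S, φ.eval x ∈ S) (hcol : HasFiniteColoring f S r)
    (hlt : r < f φ.leadingCoeff * t ^ φ.natDegree) : HasFiniteColoring f S s := by
  obtain ⟨N, κ, hκ⟩ := hcol
  have : ∀ c : Fin N, HasFiniteColoring f {x ∈ S | κ (φ.eval x) = c} s := fun c =>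
    hf.hasFiniteColoring_of_eval hφ hs hst ht (fun x hx y hy =>
      hκ _ (hS x hx.1) _ (hS y hy.1) (hx.2.trans hy.2.symm)) hlt
  choose N' κ' hκ' using this
  refine .of_finite (α := Fin N × ∀ c, Fin (N' c)) (fun x => (κ (φ.eval x), fun c => κ' c x))
    fun x hx y hy e => ?_
  rw [Prod.mk.injEq] at e
  exact hκ' (κ (φ.eval x)) x ⟨hx, rfl⟩ y ⟨hy, e.1.symm⟩ (congrFun e.2 _)

/-- A bounded set that is stable under a polynomial is a finite union of sets whose diameters are
at most the capacity of the filled Julia set. -/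
theorem IsNonarchimedean.exists_hasFiniteColoring (hf : IsNonarchimedean f)
    (hdisc : ∀ x ≠ 0, ∃ k : ℤ, f x = Real.exp k) (hφ : 2 ≤ φ.natDegree) {S : Set K}
    (hS : ∀ x ∈ S, φ.eval x ∈ S) {B : ℝ} (hB : ∀ x ∈ S, f x ≤ B) :
    ∃ r : ℝ, 0 ≤ r ∧ f φ.leadingCoeff * r ^ (φ.natDegree - 1) ≤ 1 ∧ HasFiniteColoring f S r := by
  have hl : 0 < f φ.leadingCoeff := f.pos (leadingCoeff_ne_zero.mpr (by rintro rfl; simp at hφ))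
  obtain ⟨d, hd⟩ : ∃ d, φ.natDegree = d + 2 := ⟨φ.natDegree - 2, by omega⟩
  -- The radius shrinks by a factor `e`, the step of the value group. From `ρ = e^m` to `e^(m-1)`
  -- one needs `ρ < |c| ρ^d`, which says exactly that `|c| ρ^(d-1) ≤ 1` still fails.
  have hstep : ∀ k : ℕ, (∃ r : ℝ, 0 ≤ r ∧ f φ.leadingCoeff * r ^ (φ.natDegree - 1) ≤ 1 ∧
      HasFiniteColoring f S r) ∨ HasFiniteColoring f S (Real.exp ((⌈B⌉ - k : ℤ) : ℝ)) := by
    intro k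
    induction k with
    | zero =>
      refine .inr ⟨1, fun _ => 0, fun x hx y hy _ => ?_⟩
      have hBe : B ≤ Real.exp ((⌈B⌉ - (0 : ℕ) : ℤ) : ℝ) := by
        push_cast
        rw [sub_zero]
        linarith [Int.le_ceil B, Real.add_one_le_exp (⌈B⌉ : ℝ)]
      exact hf.sub_le ((hB x hx).trans hBe) ((hB y hy).trans hBe)
    | succ k ih =>
      rcases ih with ih | ih
      · exact .inl ih
      · by_cases hle : f φ.leadingCoeff *
            Real.exp ((⌈B⌉ - k : ℤ) : ℝ) ^ (φ.natDegree - 1) ≤ 1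
        · exact .inl ⟨_, (Real.exp_pos _).le, hle, ih⟩
        · right
          refine hf.hasFiniteColoring_step (t := Real.exp ((⌈B⌉ - k : ℤ) : ℝ)) (by omega)
            (Real.exp_pos _).le (fun z hz => ?_) (Real.exp_pos _) hS ih ?_
          · have hz0 : z ≠ 0 := by
              rintro rfl
              rw [map_zero] at hz
              exact hz.not_gt (Real.exp_pos _)
            obtain ⟨j, hj⟩ := hdisc z hz0
            rw [hj, Real.exp_lt_exp, Int.cast_lt] at hz
            rw [hj, Real.exp_le_exp, Int.cast_le]
            push_cast at hz
            omega
          · push Not at hle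
            have hpos := Real.exp_pos ((⌈B⌉ - k : ℤ) : ℝ)
            rw [hd] at hle ⊢
            calc Real.exp ((⌈B⌉ - k : ℤ) : ℝ) = 1 * Real.exp ((⌈B⌉ - k : ℤ) : ℝ) := (one_mul _).symm
              _ < _ := mul_lt_mul_of_pos_right hle hpos
              _ = _ := by
                rw [show d + 2 - 1 = d + 1 by omega, mul_assoc, ← pow_succ]
  -- For this `k` the radius is at most `1` and at most `1 / |c|`, so the bound holds if it did not
  -- hold earlier.
  obtain ⟨k, hk⟩ := exists_nat_ge (|Real.log (f φ.leadingCoeff)| + ⌈B⌉)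
  rcases hstep k with h | h
  · exact h
  refine ⟨_, (Real.exp_pos _).le, ?_, h⟩
  have hlog : Real.log (f φ.leadingCoeff) + ((⌈B⌉ - k : ℤ) : ℝ) ≤ 0 := by
    push_cast
    linarith [le_abs_self (Real.log (f φ.leadingCoeff))]
  have hneg : ((⌈B⌉ - k : ℤ) : ℝ) ≤ 0 := by
    push_cast
    linarith [abs_nonneg (Real.log (f φ.leadingCoeff))]
  calc f φ.leadingCoeff * Real.exp ((⌈B⌉ - k : ℤ) : ℝ) ^ (φ.natDegree - 1)
      ≤ f φ.leadingCoeff * Real.exp ((⌈B⌉ - k : ℤ) : ℝ) :=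
        mul_le_mul_of_nonneg_left (pow_le_of_le_one (Real.exp_pos _).le
          (Real.exp_le_one_iff.mpr hneg) (by omega)) hl.le
    _ = Real.exp (Real.log (f φ.leadingCoeff) + ((⌈B⌉ - k : ℤ) : ℝ)) := by
        rw [Real.exp_add, Real.exp_log hl]
    _ ≤ 1 := Real.exp_le_one_iff.mpr hlog

end Coloring

/-! ### Descent of coefficients and affine conjugation -/

theorem Polynomial.coeff_mem_of_infinite_eval_mem {F K : Type*} [Field F] [Field K] [Algebra F K]
    (k : IntermediateField F K) {P : K[X]} {T : Set K} (hT : T.Infinite)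
    (hTk : ∀ x ∈ T, x ∈ k) (hP : ∀ x ∈ T, P.eval x ∈ k) (i : ℕ) : P.coeff i ∈ k := by
  classical
  obtain ⟨s, hs, hcard⟩ := hT.exists_subset_card_eq (P.natDegree + 1)
  have hlift : P ∈ lifts (algebraMap k K) := by
    rw [Lagrange.eq_interpolate (f := P) (s := s) (v := id) Function.injective_id.injOn
      (by rw [hcard]; exact degree_le_natDegree.trans_lt (by exact_mod_cast Nat.lt_succ_self _)),
      Lagrange.interpolate_apply]
    have hC : ∀ x ∈ k, C x ∈ lifts (algebraMap k K) := fun x hx =>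
      C_mem_lifts (algebraMap k K) ⟨x, hx⟩
    refine sum_mem fun x hx => mul_mem (hC _ (hP x (hs hx))) ?_
    refine prod_mem fun y hy => mul_mem (hC _ ?_) ?_
    · exact k.inv_mem (k.sub_mem (hTk x (hs hx)) (hTk y (hs (Finset.mem_of_mem_erase hy))))
    · rw [sub_eq_add_neg, ← C_neg]
      exact add_mem (X_mem_lifts _) (hC _ (k.neg_mem (hTk y (hs (Finset.mem_of_mem_erase hy)))))
  obtain ⟨c, hc⟩ := (lifts_iff_coeff_lifts P).mp hlift i
  rw [← hc]
  exact c.2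

section AffineConj

variable {K : Type*} [Field K] {a b : K} {φ : K[X]}

theorem eval_affineConj (a b w : K) (φ : K[X]) :
    (affineConj a b φ).eval w = (φ.eval (a * w + b) - b) / a := by
  simp [affineConj, div_eq_inv_mul]

theorem natDegree_affineConj (ha : a ≠ 0) : (affineConj a b φ).natDegree = φ.natDegree := by
  rw [affineConj, natDegree_C_mul (inv_ne_zero ha), natDegree_sub_C, natDegree_comp,
    natDegree_linear ha, mul_one]

theorem leadingCoeff_affineConj (ha : a ≠ 0) (hφ : 0 < φ.natDegree) :
    (affineConj a b φ).leadingCoeff = φ.leadingCoeff * a ^ (φ.natDegree - 1) := by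
  have hcomp : (φ.comp (C a * X + C b)).natDegree = φ.natDegree := by
    rw [natDegree_comp, natDegree_linear ha, mul_one]
  have h1 : (φ.comp (C a * X + C b)).leadingCoeff = φ.leadingCoeff * a ^ φ.natDegree := by
    rw [leadingCoeff_comp (by rw [natDegree_linear ha]; exact one_ne_zero),
      leadingCoeff_linear ha]
  rw [leadingCoeff, natDegree_affineConj ha, affineConj, coeff_C_mul, coeff_sub,
    coeff_C_of_ne_zero hφ.ne', sub_zero]
  rw [leadingCoeff, hcomp] at h1
  rw [h1]
  obtain ⟨d, hd⟩ : ∃ d, φ.natDegree = d + 1 := ⟨φ.natDegree - 1, by omega⟩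
  rw [hd, Nat.add_sub_cancel, pow_succ]
  field_simp

theorem HasBoundedOrbit.affineConj {f : AbsoluteValue K ℝ} (hf : IsNonarchimedean f) (ha : a ≠ 0)
    (h : HasBoundedOrbit f φ b) : HasBoundedOrbit f (affineConj a b φ) 0 := by
  obtain ⟨B, hB⟩ := h
  refine ⟨B / f a, fun n => ?_⟩
  have key : ∀ n : ℕ, (fun y : K => (_root_.affineConj a b φ).eval y)^[n] 0 =
      ((fun y : K => φ.eval y)^[n] b - b) / a := by
    intro n
    induction n with
    | zero => simp
    | succ n ih =>
      rw [Function.iterate_succ_apply', ih, Function.iterate_succ_apply', eval_affineConj,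
        mul_div_cancel₀ _ ha, sub_add_cancel]
  rw [key, map_div₀]
  exact div_le_div_of_nonneg_right (hf.sub_le (hB n) (hB 0)) (f.nonneg a)

end AffineConj

/-! ### Finiteness of the points with bounded orbits everywhere -/

section FunctionField

variable {F K : Type*} [Field F] [Field K] [Algebra F K]
  [Algebra (RatFunc F) K] [IsScalarTower F (RatFunc F) K] [FunctionField F K]

theorem FunctionField.exists_coeff_bound {φ : K[X]} (hφ : φ ≠ 0) :
    ∃ M : Place F K → ℝ, {v | M v ≠ 1}.Finite ∧ ∀ v, 1 ≤ M v ∧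
      (∀ i, v.absVal (φ.coeff i) ≤ M v) ∧ 1 ≤ M v * v.absVal φ.leadingCoeff := by
  choose M hM hc hl hM1 using fun v : Place F K => _root_.exists_coeff_bound v.absVal hφ
  refine ⟨M, ?_, fun v => ⟨hM v, hc v, hl v⟩⟩
  refine (φ.support.finite_toSet.biUnion fun i hi =>
    finite_setOf_absVal_ne_one (F := F) (mem_support_iff.mp hi)).subset fun v hv => ?_
  by_contra h
  refine hv (hM1 v fun i hi => ?_)
  by_contra hne
  exact h (Set.mem_biUnion (Finset.mem_coe.mpr hi) hne)

/-- If infinitely many points have bounded orbits at all places, then infinitely many of them are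
so close to each other at all places that their differences are constant multiples of each
other. -/
theorem FunctionField.exists_infinite_close {φ : K[X]} (hdeg : 2 ≤ φ.natDegree)
    (hinf : {x : K | ∀ v : Place F K, HasBoundedOrbit v.absVal φ x}.Infinite) :
    ∃ W ⊆ {x : K | ∀ v : Place F K, HasBoundedOrbit v.absVal φ x}, W.Infinite ∧
      ∀ x ∈ W, ∀ y ∈ W, ∀ v : Place F K,
        v.absVal φ.leadingCoeff * v.absVal (x - y) ^ (φ.natDegree - 1) ≤ 1 ∧
        v.absVal φ.leadingCoeff * v.absVal (φ.eval x - φ.eval y) ^ (φ.natDegree - 1) ≤ 1 := by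
  set S := {x : K | ∀ v : Place F K, HasBoundedOrbit v.absVal φ x} with hSdef
  have hφ0 : φ ≠ 0 := by rintro rfl; simp at hdeg
  obtain ⟨M, hMfin, hM⟩ := exists_coeff_bound (F := F) hφ0
  have hbd : ∀ v : Place F K, ∀ x, HasBoundedOrbit v.absVal φ x → v.absVal x ≤ M v ^ 2 :=
    fun v x hx => hx.absVal_le (hM v).1 (hM v).2.1 (hM v).2.2 v.isNonarchimedean_absVal hdeg
  have hcol := fun v : Place F K => v.isNonarchimedean_absVal.exists_hasFiniteColoring
    (fun x hx => v.exists_absVal_eq_exp hx) hdeg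
    (S := {x | HasBoundedOrbit v.absVal φ x}) (fun x hx => HasBoundedOrbit.eval hx) (hbd v)
  choose r hr0 hr N κ hκ using hcol
  have hclose : ∀ v : Place F K, ∀ x ∈ S, ∀ y ∈ S, (M v ≠ 1 → κ v x = κ v y) →
      v.absVal φ.leadingCoeff * v.absVal (x - y) ^ (φ.natDegree - 1) ≤ 1 := by
    intro v x hx y hy hxy
    by_cases hv : M v = 1
    · have h1 : v.absVal (x - y) ≤ 1 := v.isNonarchimedean_absVal.sub_le
        (by simpa [hv] using hbd v x (hx v)) (by simpa [hv] using hbd v y (hy v))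
      exact mul_le_one₀ (hv ▸ (hM v).2.1 _) (by positivity) (pow_le_one₀ (v.absVal.nonneg _) h1)
    · exact (mul_le_mul_of_nonneg_left (pow_le_pow_left₀ (v.absVal.nonneg _)
        (hκ v x (hx v) y (hy v) (hxy hv)) _) (v.absVal.nonneg _)).trans (hr v)
  have : Infinite S := hinf.to_subtype
  have : Finite {v | M v ≠ 1} := hMfin.to_subtype
  -- Pigeonhole over the finitely many bad places. The colour of `φ.eval x` is recorded too, so that
  -- images are close as well.
  obtain ⟨c, hc⟩ := Finite.exists_infinite_fiber
    (fun (x : S) (v : {v | M v ≠ 1}) => (κ v x.1, κ v (φ.eval x.1)))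
  have hSeval : ∀ x ∈ S, φ.eval x ∈ S := fun x hx v => (hx v).eval
  refine ⟨Subtype.val '' _, Subtype.coe_image_subset S _,
    (Set.infinite_coe_iff.mp hc).image Subtype.val_injective.injOn, ?_⟩
  rintro _ ⟨x, hx, rfl⟩ _ ⟨y, hy, rfl⟩ v
  have hxy : ∀ hv : M v ≠ 1, (κ v x.1, κ v (φ.eval x.1)) = (κ v y.1, κ v (φ.eval y.1)) :=
    fun hv => congrFun ((show _ = c from hx).trans (show _ = c from hy).symm) ⟨v, hv⟩
  exact ⟨hclose v _ x.2 _ y.2 fun hv => congrArg Prod.fst (hxy hv),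
    hclose v _ (hSeval _ x.2) _ (hSeval _ y.2) fun hv => congrArg Prod.snd (hxy hv)⟩

theorem FunctionField.finite_setOf_hasBoundedOrbit {φ : K[X]} (hdeg : 2 ≤ φ.natDegree)
    (hφ : ¬ ∃ a b : K, a ≠ 0 ∧ IsDefinedOverConstants F (affineConj a b φ)) :
    {x : K | ∀ v : Place F K, HasBoundedOrbit v.absVal φ x}.Finite := by
  by_contra hinf
  obtain ⟨W, hWS, hWinf, hW⟩ := exists_infinite_close hdeg hinf
  have hφ0 : φ ≠ 0 := by rintro rfl; simp at hdeg
  obtain ⟨x₁, hx₁, x₀, hx₀, hne⟩ := hWinf.nontrivial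
  set a := x₁ - x₀ with ha_def
  have ha : a ≠ 0 := sub_ne_zero.mpr hne
  set u := φ.leadingCoeff * a ^ (φ.natDegree - 1) with hu_def
  have hu0 : u ≠ 0 := mul_ne_zero (leadingCoeff_ne_zero.mpr hφ0) (pow_ne_zero _ ha)
  have hu : IsAlgebraic F u := isAlgebraic_of_forall_absVal_le_one fun v => by
    rw [hu_def, map_mul, map_pow]
    exact (hW x₁ hx₁ x₀ hx₀ v).1
  have hconst : ∀ z : K, (∀ v : Place F K,
      v.absVal φ.leadingCoeff * v.absVal z ^ (φ.natDegree - 1) ≤ 1) →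
      z / a ∈ algebraicClosure F K := fun z hz => by
    refine mem_algebraicClosure_iff.mpr (isAlgebraic_of_forall_absVal_le_one fun v => ?_)
    -- Since `u` is a nonzero constant, `a` attains the bound at every place, so `|z| ≤ |a|`
    -- everywhere.
    have hu1 := v.absVal_eq_one_of_isAlgebraic hu hu0
    rw [hu_def, map_mul, map_pow] at hu1
    have hle := (hz v).trans hu1.ge
    rw [mul_le_mul_iff_right₀ (v.absVal.pos (leadingCoeff_ne_zero.mpr hφ0))] at hle
    have := (pow_le_pow_iff_left₀ (v.absVal.nonneg _) (v.absVal.nonneg _) (by omega)).mp hle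
    rw [map_div₀]
    exact div_le_one_of_le₀ this (v.absVal.nonneg _)
  set Φ := affineConj a x₀ φ with hΦ_def
  have hΦdeg : Φ.natDegree = φ.natDegree := natDegree_affineConj ha
  have hΦl : Φ.leadingCoeff = u := leadingCoeff_affineConj ha (by omega)
  have heval : ∀ x, Φ.eval ((x - x₀) / a) = (φ.eval x - x₀) / a := fun x => by
    rw [hΦ_def, eval_affineConj, mul_div_cancel₀ _ ha, sub_add_cancel]
  have hcoeff : ∀ i ≠ 0, Φ.coeff i ∈ algebraicClosure F K := by
    have hT : ((fun x => (x - x₀) / a) '' W).Infinite := hWinf.image fun x _ y _ h => by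
      simpa [div_left_inj' ha] using h
    -- Only differences of values are known to be constant at this stage, hence the subtraction of
    -- `Φ.eval 0`.
    have := Polynomial.coeff_mem_of_infinite_eval_mem (algebraicClosure F K)
      (P := Φ - C (Φ.eval 0)) hT ?_ ?_
    · intro i hi
      simpa [coeff_C_of_ne_zero hi] using this i
    · rintro _ ⟨x, hx, rfl⟩
      exact hconst _ fun v => (hW x hx x₀ hx₀ v).1
    · rintro _ ⟨x, hx, rfl⟩
      have h0 := heval x₀
      rw [sub_self, zero_div] at h0
      rw [eval_sub, eval_C, heval, h0, ← sub_div, sub_sub_sub_cancel_right]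
      exact hconst _ fun v => (hW x hx x₀ hx₀ v).2
  refine hφ ⟨a, x₀, ha, fun i => ?_⟩
  rcases eq_or_ne i 0 with rfl | hi
  · refine mem_algebraicClosure_iff.mpr (isAlgebraic_of_forall_absVal_le_one fun v => ?_)
    refine HasBoundedOrbit.absVal_coeff_zero_le_one v.isNonarchimedean_absVal (hΦdeg ▸ hdeg)
      (fun i hi => v.absVal_le_one_of_isAlgebraic (mem_algebraicClosure_iff.mp (hcoeff i hi)))
      (hΦl ▸ v.absVal_eq_one_of_isAlgebraic hu hu0)
      ((hWS hx₀ v).affineConj v.isNonarchimedean_absVal ha)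
  · exact hcoeff i hi

end FunctionField

/-! ### Heights and Tate's limit -/

section Limit

variable {α : Type*} {g : α → α} {h : α → ℝ} {d C : ℝ}

theorem exists_tendsto_iterate_div_pow (hd : 1 < d) (hC : ∀ x, |h (g x) - d * h x| ≤ C) (x : α) :
    ∃ l, Tendsto (fun n : ℕ => h (g^[n] x) / d ^ n) atTop (𝓝 l) ∧
      |l - h x| ≤ C / d / (1 - 1 / d) := by
  have hd0 : 0 < d := by linarith
  have hdist : ∀ n : ℕ, dist (h (g^[n] x) / d ^ n) (h (g^[n + 1] x) / d ^ (n + 1)) ≤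
      C / d * (1 / d) ^ n := by
    intro n
    have e : h (g^[n] x) / d ^ n - h (g^[n + 1] x) / d ^ (n + 1) =
        -((h (g (g^[n] x)) - d * h (g^[n] x)) / d ^ (n + 1)) := by
      rw [Function.iterate_succ_apply', pow_succ]
      field_simp
      ring
    rw [Real.dist_eq, e, abs_neg, abs_div, abs_of_pos (pow_pos hd0 (n + 1)),
      show C / d * (1 / d) ^ n = C / d ^ (n + 1) by
        rw [one_div, inv_pow, pow_succ]; field_simp]
    exact div_le_div_of_nonneg_right (hC _) (by positivity)
  have hr : 1 / d < 1 := (div_lt_one hd0).mpr hd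
  obtain ⟨l, hl⟩ := cauchySeq_tendsto_of_complete (cauchySeq_of_le_geometric _ _ hr hdist)
  refine ⟨l, hl, ?_⟩
  have := dist_le_of_le_geometric_of_tendsto₀ _ _ hr hdist hl
  rwa [dist_comm, Real.dist_eq, Function.iterate_zero_apply, pow_zero, div_one] at this

end Limit

section PolyMap

variable {K : Type*} [Field K] (φ : K[X])

theorem polyMap_infty : polyMap φ OnePoint.infty = OnePoint.infty := rfl

theorem iterate_polyMap_some (n : ℕ) (x : K) :
    (polyMap φ)^[n] (OnePoint.some x) = OnePoint.some ((fun y : K => φ.eval y)^[n] x) :=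
  (Function.Semiconj.iterate_right (f := (OnePoint.some : K → OnePoint K))
    (ga := fun y : K => φ.eval y) (gb := polyMap φ) (fun _ => rfl) n x).symm

end PolyMap

section Height

variable {F K : Type*} [Field F] [Field K] [Algebra F K]

theorem height_infty : height F (OnePoint.infty : OnePoint K) = 0 := by
  simp [height]

theorem height_some (x : K) : height F (OnePoint.some x) =
    ∑ᶠ v : Place F K, (v.degree : ℝ) * Real.log (max (v.absVal x) 1) := by
  simp [height]

theorem Place.localHeight_nonneg (v : Place F K) (x : K) :
    0 ≤ (v.degree : ℝ) * Real.log (max (v.absVal x) 1) :=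
  mul_nonneg (Nat.cast_nonneg _) (Real.log_nonneg (le_max_right _ _))

variable [Algebra (RatFunc F) K] [IsScalarTower F (RatFunc F) K] [FunctionField F K]

/-- Needed since `finsum` takes the value `0` on infinite support. -/
theorem FunctionField.finite_support_localHeight (x : K) :
    (Function.support fun v : Place F K =>
      (v.degree : ℝ) * Real.log (max (v.absVal x) 1)).Finite := by
  refine (finite_setOf_one_lt_absVal x).subset fun v hv => ?_
  by_contra h
  have h' : v.absVal x ≤ 1 := not_lt.mp h
  exact hv (by simp [max_eq_right h'])

theorem FunctionField.localHeight_le_height (v : Place F K) (x : K) :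
    Real.log (max (v.absVal x) 1) ≤ height F (OnePoint.some x) := by
  rw [height_some]
  have hd : (1 : ℝ) ≤ v.degree := by exact_mod_cast v.degree_pos
  calc Real.log (max (v.absVal x) 1)
      ≤ (v.degree : ℝ) * Real.log (max (v.absVal x) 1) :=
        le_mul_of_one_le_left (Real.log_nonneg (le_max_right _ _)) hd
    _ ≤ _ := single_le_finsum v (finite_support_localHeight x) fun w => w.localHeight_nonneg x

/-- The local errors are at most `2 d log (M v)`, which vanishes for almost all `v`, so their
weighted sum is a constant independent of `x`. -/
theorem FunctionField.exists_abs_height_polyMap_sub_le {φ : K[X]} (hdeg : 1 ≤ φ.natDegree) :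
    ∃ C : ℝ, ∀ x, |height F (polyMap φ x) - φ.natDegree * height F x| ≤ C := by
  classical
  have hφ0 : φ ≠ 0 := by rintro rfl; simp at hdeg
  obtain ⟨M, hMfin, hM⟩ := exists_coeff_bound (F := F) hφ0
  have hC : ∀ v : Place F K, 0 ≤ (v.degree : ℝ) * (2 * φ.natDegree * Real.log (M v)) := fun v =>
    mul_nonneg (Nat.cast_nonneg _) (mul_nonneg (by positivity) (Real.log_nonneg (hM v).1))
  refine ⟨∑ᶠ v : Place F K, (v.degree : ℝ) * (2 * φ.natDegree * Real.log (M v)), fun x => ?_⟩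
  induction x using OnePoint.rec with
  | infty =>
    rw [polyMap_infty, height_infty, mul_zero, sub_zero, abs_zero]
    exact finsum_nonneg hC
  | coe x =>
    change |height F (OnePoint.some (φ.eval x)) - _| ≤ _
    have hA := finite_support_localHeight (F := F) (φ.eval x)
    have hB := finite_support_localHeight (F := F) x
    let s := hA.toFinset ∪ hB.toFinset ∪ hMfin.toFinset
    rw [height_some, height_some,
      finsum_eq_sum_of_support_subset (s := s) _ (fun v hv => Finset.mem_coe.mpr
        (Finset.mem_union_left _ (Finset.mem_union_left _ (hA.mem_toFinset.mpr hv)))),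
      finsum_eq_sum_of_support_subset (s := s) _ (fun v hv => Finset.mem_coe.mpr
        (Finset.mem_union_left _ (Finset.mem_union_right _ (hB.mem_toFinset.mpr hv)))),
      finsum_eq_sum_of_support_subset (s := s) _ (fun v hv => by
        have : M v ≠ 1 := fun h => hv (by simp [h])
        simp [s, this]), Finset.mul_sum, ← Finset.sum_sub_distrib]
    refine (Finset.abs_sum_le_sum_abs _ _).trans (Finset.sum_le_sum fun v _ => ?_)
    rw [mul_left_comm, ← mul_sub, abs_mul, Nat.abs_cast]
    exact mul_le_mul_of_nonneg_left (v.isNonarchimedean_absVal.abs_log_eval_sub_le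
      (hM v).1 (hM v).2.1 (hM v).2.2 hdeg x) (Nat.cast_nonneg _)

theorem FunctionField.tendsto_canonicalHeight {φ : K[X]} (hdeg : 2 ≤ φ.natDegree)
    (x : OnePoint K) : Tendsto (fun n : ℕ => height F ((polyMap φ)^[n] x) /
      (φ.natDegree : ℝ) ^ n) atTop (𝓝 (canonicalHeight F φ x)) := by
  obtain ⟨C, hC⟩ := exists_abs_height_polyMap_sub_le (F := F) (one_le_two.trans hdeg)
  obtain ⟨l, hl, -⟩ := exists_tendsto_iterate_div_pow
    (show (1 : ℝ) < φ.natDegree by exact_mod_cast hdeg) hC x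
  exact tendsto_nhds_limUnder ⟨l, hl⟩

theorem FunctionField.isCanonicalHeight_canonicalHeight {φ : K[X]} (hdeg : 2 ≤ φ.natDegree) :
    IsCanonicalHeight F φ (canonicalHeight F φ) := by
  have hd0 : (φ.natDegree : ℝ) ≠ 0 := by
    have : φ.natDegree ≠ 0 := by omega
    exact_mod_cast this
  refine ⟨fun x => ?_, ?_⟩
  · refine tendsto_nhds_unique (tendsto_canonicalHeight hdeg _) ?_
    refine (((tendsto_canonicalHeight hdeg x).comp (tendsto_add_atTop_nat 1)).const_mul
      (φ.natDegree : ℝ)).congr fun n => ?_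
    rw [Function.comp_apply, Function.iterate_succ_apply, pow_succ]
    field_simp
  · obtain ⟨C, hC⟩ := exists_abs_height_polyMap_sub_le (F := F) (one_le_two.trans hdeg)
    refine ⟨C / φ.natDegree / (1 - 1 / φ.natDegree), fun x => ?_⟩
    obtain ⟨l, hl, hle⟩ := exists_tendsto_iterate_div_pow
      (show (1 : ℝ) < φ.natDegree by exact_mod_cast hdeg) hC x
    rwa [tendsto_nhds_unique hl (tendsto_canonicalHeight hdeg x)] at hle

end Height

/-! ### Zeros of the canonical height -/

section CanonicalHeight

variable {F K : Type*} [Field F] [Field K] [Algebra F K] {φ : K[X]} {H : OnePoint K → ℝ}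

theorem IsCanonicalHeight.iterate (hH : IsCanonicalHeight F φ H) (n : ℕ) (x : OnePoint K) :
    H ((polyMap φ)^[n] x) = (φ.natDegree : ℝ) ^ n * H x := by
  induction n with
  | zero => simp
  | succ n ih => rw [Function.iterate_succ_apply', hH.1, ih, pow_succ']; ring

theorem IsCanonicalHeight.eq_zero_of_isPreperiodic (hH : IsCanonicalHeight F φ H)
    (hdeg : 2 ≤ φ.natDegree) {x : OnePoint K} (hx : IsPreperiodic (polyMap φ) x) : H x = 0 := by
  obtain ⟨m, n, hmn, e⟩ := hx
  have h := congrArg H e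
  rw [hH.iterate, hH.iterate] at h
  by_contra hne
  exact (pow_lt_pow_right₀ (show (1 : ℝ) < φ.natDegree by exact_mod_cast hdeg) hmn).ne
    (mul_right_cancel₀ hne h)

theorem IsCanonicalHeight.isPreperiodic_of_eq_zero (hH : IsCanonicalHeight F φ H)
    (hfin : {x | H x = 0}.Finite) {x : OnePoint K} (hx : H x = 0) :
    IsPreperiodic (polyMap φ) x := by
  have : Finite {x | H x = 0} := hfin.to_subtype
  obtain ⟨m, n, hmn, e⟩ := Finite.exists_ne_map_eq_of_infinite
    fun n : ℕ => (⟨(polyMap φ)^[n] x, by simp [hH.iterate, hx]⟩ : {x | H x = 0})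
  have e' := congrArg Subtype.val e
  rcases hmn.lt_or_gt with h | h
  · exact ⟨m, n, h, e'⟩
  · exact ⟨n, m, h, e'.symm⟩

theorem IsCanonicalHeight.hasBoundedOrbit [Algebra (RatFunc F) K] [IsScalarTower F (RatFunc F) K]
    [FunctionField F K] (hH : IsCanonicalHeight F φ H) {x : K} (hx : H (OnePoint.some x) = 0)
    (v : Place F K) : HasBoundedOrbit v.absVal φ x := by
  obtain ⟨C, hC⟩ := hH.2
  refine ⟨Real.exp C, fun n => ?_⟩
  have h := hC ((polyMap φ)^[n] (OnePoint.some x))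
  rw [hH.iterate, hx, mul_zero, zero_sub, abs_neg, iterate_polyMap_some] at h
  have hlog := (FunctionField.localHeight_le_height v _).trans ((le_abs_self _).trans h)
  exact (le_max_left _ _).trans ((Real.log_le_iff_le_exp (by positivity)).mp hlog)

end CanonicalHeight

theorem theoremA (F K : Type*) [Field F] [Field K] [Algebra F K] [Algebra (RatFunc F) K]
    [IsScalarTower F (RatFunc F) K] [FunctionField F K]
    (φ : K[X]) (hdeg : 2 ≤ φ.natDegree)
    (hφ : ¬ ∃ a b : K, a ≠ 0 ∧ IsDefinedOverConstants F (affineConj a b φ)) :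
    IsCanonicalHeight F φ (canonicalHeight F φ) ∧
      (∀ x : OnePoint K, IsPreperiodic (polyMap φ) x ↔ canonicalHeight F φ x = 0) ∧
      {x : OnePoint K | canonicalHeight F φ x = 0}.Finite := by
  have hH := FunctionField.isCanonicalHeight_canonicalHeight (F := F) hdeg
  have hfin : {x : OnePoint K | canonicalHeight F φ x = 0}.Finite := by
    refine (((FunctionField.finite_setOf_hasBoundedOrbit hdeg hφ).image OnePoint.some).insert
      OnePoint.infty).subset fun x hx => ?_
    induction x using OnePoint.rec with
    | infty => exact .inl rfl
    | coe x => exact .inr ⟨x, hH.hasBoundedOrbit hx, rfl⟩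
  exact ⟨hH, fun x => ⟨hH.eq_zero_of_isPreperiodic hdeg, hH.isPreperiodic_of_eq_zero hfin⟩, hfin⟩
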